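/- For integers $1\le r\le n$ let $B_{r,n}(z)=\sum_{k=0}^{r}\binom{n}{k}z^k$, and for $0<\alpha<1$ let $$K_\alpha=\alpha^\alpha(1-\alpha)^{1-\alpha},\qquad C_\alpha=\left\{z\in\mathbb{C}\;:\;\frac{|z|^\alpha}{|1+z|}=K_\alpha,\ |z|\le\frac{\alpha}{1-\alpha}\right\}.$$ Let $(r_j)_{j\ge 1}$ and $(n_j)_{j\ge 1}$ be sequences of integers with $1\le r_j<n_j-1$ for all $j$, and suppose that $\lim_{j\to\infty}n_j=\infty$ and $\lim_{j\to\infty}r_j/n_j=\alpha$, where $0<\alpha<1$. Then: 1. The zeros of $B_{r_j,n_j}$ converge uniformly to points of the curve $C_\alpha$, that is, $$\sup_{z:\,B_{r_j,n_j}(z)=0}d(z,C_\alpha)\to 0\quad(j\to\infty),\qquad\text{where } d(z,C_\alpha)=\inf_{\zeta\in C_\alpha}|z-\zeta|.$$ 2. Each point of $C_\alpha$ is a limit point of zeros of the polynomials $B_{r_j,n_j}$: for every $\zeta\in C_\alpha$ there are $z_j\in\mathbb{C}$ with $B_{r_j,n_j}(z_j)=0$ for all $j$ and $z_j\to\zeta$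 as $j\to\infty$. -/

import Mathlib

open Filter Topology

/-- The section `B_{r,n}(z) = ∑_{k=0}^r (n choose k) z^k` of the binomial expansion of `(1+z)^n`. -/
def binomialSection (r n : ℕ) (z : ℂ) : ℂ :=
  ∑ k ∈ Finset.range (r + 1), (n.choose k : ℂ) * z ^ k

/-- The set of (complex) zeros of `B_{r,n}`. -/
def sectionZeros (r n : ℕ) : Set ℂ :=
  {z : ℂ | binomialSection r n z = 0}

/-- The constant `K_α = α^α (1-α)^(1-α)`. -/
noncomputable def curveConst (α : ℝ) : ℝ :=
  α ^ α * (1 - α) ^ (1 - α)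

/-- The curve `C_α = {z : |z|^α / |1+z| = K_α, |z| ≤ α/(1-α)}`, for `0 < α < 1`.
The point `z = -1`, where the quotient is undefined, does not belong to this set: there the quotient
takes the value `0` by convention, whereas `K_α > 0`. -/
def limitCurve (α : ℝ) : Set ℂ :=
  {z : ℂ | ‖z‖ ^ α / ‖1 + z‖ = curveConst α ∧ ‖z‖ ≤ α / (1 - α)}

/-!
Write `(1 + z) ^ n = B(z) + C(n, r+1) z ^ (r+1) T(z)`, where `B = B_{r,n}` and `T` is the normalised tail
of the binomial expansion (`tailQuotient`). Zeros of `B` are the points where `(1 + z) ^ n` equals the tail.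

Everything rests on one estimate of Eneström–Kakeya type, `le_re_one_sub_mul_sum`, for sums
`∑ b k * w ^ k` with decreasing coefficients. Applied to the reversed coefficients of `B` it confines all
zeros to the disc `‖z‖ ≤ ρ`, `ρ = r / (n - r)`. Applied to `T` it shows that on this disc
`(1 - z / ρ) T(z)` has real part at least `(1 - Re (z / ρ)) / n`, while trivially `‖T‖ ≤ n`. Hence the factor
`‖T‖ ^ (1 / n)` tends to `1` away from the point `z = α / (1 - α)`, up to and including the boundary circle.

Since `C(n, r+1) ^ (1 / n)` tends to `1 / K_α` by Stirling's formula (`tendsto_log_choose_div`), taking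
`n`-th roots of `‖1 + z‖ ^ n = C(n, r+1) ‖z‖ ^ (r+1) ‖T(z)‖` shows that every limit of zeros satisfies
`‖1 + z‖ = ‖z‖ ^ α / K_α` (`mem_limitCurve_of_tendsto_zeros`). Compactness of the disc then gives the
uniform statement.

Conversely, near a point of the curve inside the open disc, `T` has a holomorphic logarithm that is
`O(log n)`, because `(1 - z / ρ) T(z)` and `1 - z / ρ` both have positive real part. So `B(z) = 0` becomes
`exp (n ψ(z)) = 1` with `ψ` uniformly close to a function whose derivative does not vanish, and such an
equation has solutions near every point where the limit function is purely imaginary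
(`eventually_exists_exp_nat_mul_eq_one`). The only remaining point of the curve, `α / (1 - α)`, is a limit
of points of the curve inside the disc (`exists_mem_limitCurve_near_endpoint`).
-/

/-! ### Sums with decreasing coefficients -/

/-- A quantitative Eneström–Kakeya estimate. By Abel summation `(1 - w) ∑ b k * w ^ k` equals
`∑ (b k - b (k + 1)) (1 - w ^ (k + 1)) + b N (1 - w ^ (N + 1))`, where every term has nonnegative real
part; the bound keeps the term `k = 0`. -/
theorem le_re_one_sub_mul_sum {b : ℕ → ℝ} {w : ℂ} (hw : ‖w‖ ≤ 1) {N : ℕ} (hN : 1 ≤ N)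
    (hb : ∀ k < N, b (k + 1) ≤ b k) (hb0 : 0 ≤ b N) :
    (b 0 - b 1) * (1 - w.re) ≤ ((1 - w) * ∑ k ∈ Finset.range (N + 1), (b k : ℂ) * w ^ k).re := by
  have hre : ∀ k : ℕ, (w ^ k).re ≤ 1 := fun k =>
    (Complex.re_le_norm _).trans (by rw [norm_pow]; exact pow_le_one₀ (norm_nonneg _) hw)
  have key : (b 0 - b 1) * (1 - w.re) + b N * (1 - (w ^ (N + 1)).re) ≤
      ((1 - w) * ∑ k ∈ Finset.range (N + 1), (b k : ℂ) * w ^ k).re := by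
    clear hb0
    induction N, hN using Nat.le_induction with
    | base =>
      apply le_of_eq
      have : (1 - w) * ∑ k ∈ Finset.range (1 + 1), (b k : ℂ) * w ^ k =
          (b 0 : ℂ) - ((b 0 - b 1 : ℝ) : ℂ) * w - (b 1 : ℂ) * w ^ 2 := by
        rw [Finset.sum_range_succ, Finset.sum_range_one]
        push_cast
        ring
      rw [this]
      simp only [Complex.sub_re, Complex.re_ofReal_mul, Complex.ofReal_re]
      norm_num
      ring
    | succ N hN ih =>
      have ih' := ih fun k hk => hb k (by omega)
      have hsplit : (1 - w) * ∑ k ∈ Finset.range (N + 1 + 1), (b k : ℂ) * w ^ k =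
          (1 - w) * ∑ k ∈ Finset.range (N + 1), (b k : ℂ) * w ^ k +
            ((b (N + 1) : ℂ) * w ^ (N + 1) - (b (N + 1) : ℂ) * w ^ (N + 1 + 1)) := by
        rw [Finset.sum_range_succ _ (N + 1)]
        ring
      rw [hsplit, Complex.add_re, Complex.sub_re, Complex.re_ofReal_mul, Complex.re_ofReal_mul]
      have := mul_nonneg (sub_nonneg.2 (hb N (by omega))) (sub_nonneg.2 (hre (N + 1)))
      nlinarith
  have := mul_nonneg hb0 (sub_nonneg.2 (hre (N + 1)))
  linarith

/-! ### The disc containing the zeros -/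

theorem choose_succ_mul_real {n k : ℕ} (hk : k ≤ n) :
    (n.choose (k + 1) : ℝ) * (k + 1) = n.choose k * (n - k) := by
  have := Nat.choose_succ_right_eq n k
  have h2 : ((n.choose (k + 1) * (k + 1) : ℕ) : ℝ) = ((n.choose k * (n - k) : ℕ) : ℝ) := by
    rw [this]
  push_cast [Nat.cast_sub hk] at h2
  exact h2

/-- All zeros of `B_{r,n}` lie in the disc of radius `r / (n - r)`. With `ρ` that radius, if `‖z‖ > ρ`
then `B_{r,n}(z) / z ^ r` is a sum of powers of `w = ρ / z` with strictly decreasing coefficients, so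
the Eneström–Kakeya estimate makes it nonzero. -/
theorem norm_le_of_mem_sectionZeros {r n : ℕ} (hr : 1 ≤ r) (hrn : r < n) {z : ℂ}
    (hz : z ∈ sectionZeros r n) : ‖z‖ ≤ (r : ℝ) / (n - r) := by
  have hr' : (1 : ℝ) ≤ r := by exact_mod_cast hr
  have hrn' : (r : ℝ) + 1 ≤ n := by exact_mod_cast hrn
  set ρ : ℝ := (r : ℝ) / (n - r) with hρ
  have hnr : (0 : ℝ) < n - r := by linarith
  have hρ0 : 0 < ρ := by positivity
  by_contra! hlt
  have hz0 : z ≠ 0 := norm_pos_iff.1 (hρ0.trans hlt)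
  set w : ℂ := (ρ : ℂ) / z with hw
  have hw1 : ‖w‖ < 1 := by
    rw [hw, norm_div, Complex.norm_real, Real.norm_of_nonneg hρ0.le]
    exact (div_lt_one (hρ0.trans hlt)).2 hlt
  set b : ℕ → ℝ := fun i => (n.choose (r - i) : ℝ) / ρ ^ i with hb
  -- Consecutive coefficients: the ratio `C(n,j) / C(n,j+1)` is less than `ρ` for `j < r`.
  have hratio : ∀ j < r, (n.choose j : ℝ) < n.choose (j + 1) * ρ := by
    intro j hj
    have h1 := choose_succ_mul_real (n := n) (k := j) (by omega)
    have hj' : (j : ℝ) + 1 ≤ r := by exact_mod_cast hj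
    have hc : (0 : ℝ) < n.choose (j + 1) := by exact_mod_cast Nat.choose_pos (by omega)
    have h2 : (n.choose j : ℝ) = n.choose (j + 1) * ((j + 1) / (n - j)) := by
      have : (n : ℝ) - j ≠ 0 := by linarith
      field_simp
      linarith
    rw [h2]
    refine mul_lt_mul_of_pos_left ?_ hc
    rw [hρ, div_lt_div_iff₀ (by linarith) hnr]
    nlinarith
  have hstep : ∀ k < r, b (k + 1) < b k := by
    intro k hk
    have h := hratio (r - (k + 1)) (by omega)
    rw [show r - (k + 1) + 1 = r - k by omega] at h
    simp only [hb]
    rw [div_lt_div_iff₀ (by positivity) (by positivity), pow_succ]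
    have : 0 < ρ ^ k := by positivity
    nlinarith
  have hAbel := le_re_one_sub_mul_sum (b := b) hw1.le hr (fun k hk => (hstep k hk).le)
    (by simp only [hb]; positivity)
  have hsum : binomialSection r n z =
      z ^ r * ∑ k ∈ Finset.range (r + 1), (b k : ℂ) * w ^ k := by
    rw [binomialSection, ← Finset.sum_range_reflect, Finset.mul_sum]
    refine Finset.sum_congr rfl fun k hk => ?_
    have hk' : k ≤ r := by simpa [Nat.lt_succ_iff] using hk
    have hρc : (ρ : ℂ) ≠ 0 := by exact_mod_cast hρ0.ne'
    have hpow : z ^ r = z ^ (r - k) * z ^ k := by rw [← pow_add]; congr 1; omega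
    rw [show r + 1 - 1 - k = r - k by omega, hpow, hw, div_pow]
    simp only [hb]
    push_cast
    field_simp
  have h0 : ∑ k ∈ Finset.range (r + 1), (b k : ℂ) * w ^ k = 0 := by
    have h : binomialSection r n z = 0 := hz
    rw [hsum] at h
    exact (mul_eq_zero.1 h).resolve_left (pow_ne_zero _ hz0)
  rw [h0, mul_zero, Complex.zero_re] at hAbel
  have h1 : 0 < b 0 - b 1 := sub_pos.2 (hstep 0 (by omega))
  have h2 : 0 < 1 - w.re := sub_pos.2 ((Complex.re_le_norm w).trans_lt hw1)
  exact absurd hAbel (not_le.2 (mul_pos h1 h2))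

/-! ### The tail of the binomial expansion -/

/-- The normalised tail `∑ i ≤ n - m, C(n, m + i) / C(n, m) * z ^ i` of the binomial expansion: the part
of `(1 + z) ^ n` of degree at least `m`, divided by its lowest term `C(n, m) * z ^ m`. -/
noncomputable def tailQuotient (m n : ℕ) (z : ℂ) : ℂ :=
  ∑ i ∈ Finset.range (n - m + 1), ((n.choose (m + i) / n.choose m : ℝ) : ℂ) * z ^ i

theorem differentiable_tailQuotient (m n : ℕ) : Differentiable ℂ (tailQuotient m n) := by
  unfold tailQuotient
  fun_prop

theorem one_add_pow_eq_binomialSection_add {r n : ℕ} (hrn : r < n) (z : ℂ) :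
    (1 + z) ^ n =
      binomialSection r n z + n.choose (r + 1) * z ^ (r + 1) * tailQuotient (r + 1) n z := by
  have hc : (n.choose (r + 1) : ℂ) ≠ 0 := by exact_mod_cast (Nat.choose_pos (by omega)).ne'
  rw [add_comm 1 z, add_pow, binomialSection, tailQuotient,
    show n + 1 = (r + 1) + (n - (r + 1) + 1) by omega, Finset.sum_range_add, Finset.mul_sum]
  congr 1
  · exact Finset.sum_congr rfl fun k _ => by simp [mul_comm]
  · refine Finset.sum_congr rfl fun k _ => ?_
    push_cast
    field_simp
    simp only [pow_add, pow_one]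
    ring

theorem choose_mul_pow_step {r n k : ℕ} (hr : 1 ≤ r) (hrk : r ≤ k) (hkn : k < n) :
    (n.choose (k + 1) : ℝ) * ((r : ℝ) / (n - r)) ≤ n.choose k * (r / (k + 1)) := by
  have h1 := choose_succ_mul_real (n := n) (k := k) hkn.le
  have hrk' : (r : ℝ) ≤ k := by exact_mod_cast hrk
  have hkn' : (k : ℝ) + 1 ≤ n := by exact_mod_cast hkn
  have hr' : (1 : ℝ) ≤ r := by exact_mod_cast hr
  have hc : (0 : ℝ) ≤ n.choose k := by positivity
  have h2 : (n.choose (k + 1) : ℝ) = n.choose k * ((n - k) / (k + 1)) := by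
    field_simp
    linarith
  rw [h2, mul_assoc]
  refine mul_le_mul_of_nonneg_left ?_ hc
  rw [div_mul_div_comm, div_le_div_iff₀ (by nlinarith) (by linarith)]
  have : (0 : ℝ) ≤ r * (k + 1) := by positivity
  nlinarith

/-- On the circle of radius `r / (n - r)` the moduli of the terms of the tail decrease, each being at
most `r / (r + 2)` times the one before. -/
theorem choose_div_mul_pow_antitone {r n : ℕ} (hr : 1 ≤ r) {i : ℕ} (hi : r + 1 + i < n) :
    (n.choose (r + 1 + (i + 1)) / n.choose (r + 1) : ℝ) * ((r : ℝ) / (n - r)) ^ (i + 1) ≤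
      (n.choose (r + 1 + i) / n.choose (r + 1) : ℝ) * ((r : ℝ) / (n - r)) ^ i *
        (r / (r + 2)) := by
  have h := choose_mul_pow_step (k := r + 1 + i) hr (by omega) hi
  have hrn : (r : ℝ) + 1 ≤ n := by exact_mod_cast (by omega : r + 1 ≤ n)
  have hρ : (0 : ℝ) ≤ (r : ℝ) / (n - r) := div_nonneg (by positivity) (by linarith)
  have hle : (r : ℝ) / ((r + 1 + i : ℕ) + 1) ≤ r / (r + 2) := by
    push_cast
    exact div_le_div_of_nonneg_left (by positivity) (by positivity)
      (by linarith [(Nat.cast_nonneg i : (0 : ℝ) ≤ i)])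
  have h' := h.trans (mul_le_mul_of_nonneg_left hle (Nat.cast_nonneg (n.choose (r + 1 + i))))
  have h3 := mul_le_mul_of_nonneg_left h'
    (mul_nonneg (pow_nonneg hρ i) (inv_nonneg.2 (Nat.cast_nonneg (n.choose (r + 1)) : (0:ℝ) ≤ _)))
  calc _ = ((r : ℝ) / (n - r)) ^ i * (n.choose (r + 1) : ℝ)⁻¹ *
        ((n.choose (r + 1 + i + 1) : ℝ) * ((r : ℝ) / (n - r))) := by
        rw [← add_assoc (r + 1) i 1, pow_succ]; ring
    _ ≤ _ := h3
    _ = _ := by ring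

/-- The lower bound for the tail on the disc that contains all zeros of `B_{r,n}`: away from the point
`z = r / (n - r)` it loses only a factor `1 / n`, which disappears after taking `n`-th roots. It also
shows that the product on the right has a principal logarithm. -/
theorem le_re_one_sub_mul_tailQuotient {r n : ℕ} (hr : 1 ≤ r) (hrn : r + 1 < n) {z : ℂ}
    (hz : ‖z‖ ≤ (r : ℝ) / (n - r)) :
    (1 / n : ℝ) * (1 - (z / ((r : ℝ) / (n - r) : ℝ)).re) ≤
      ((1 - z / ((r : ℝ) / (n - r) : ℝ)) * tailQuotient (r + 1) n z).re := by
  have hr' : (1 : ℝ) ≤ r := by exact_mod_cast hr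
  have hrn' : (r : ℝ) + 2 ≤ n := by exact_mod_cast hrn
  set ρ : ℝ := (r : ℝ) / (n - r) with hρ
  have hρ0 : 0 < ρ := div_pos (by linarith) (by linarith)
  have hw : ‖z / (ρ : ℂ)‖ ≤ 1 := by
    rw [norm_div, Complex.norm_real, Real.norm_of_nonneg hρ0.le]
    exact (div_le_one hρ0).2 hz
  have hfac : (r : ℝ) / (r + 2) ≤ 1 := (div_le_one (by linarith)).2 (by linarith)
  have hc : (0 : ℝ) < n.choose (r + 1) := by exact_mod_cast Nat.choose_pos (by omega)
  have hAbel := le_re_one_sub_mul_sum (w := z / (ρ : ℂ)) (N := n - (r + 1))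
    (b := fun i => (n.choose (r + 1 + i) / n.choose (r + 1) : ℝ) * ρ ^ i) hw (by omega)
    (fun k hk => (choose_div_mul_pow_antitone hr (by omega)).trans
      (mul_le_of_le_one_right (by positivity) hfac)) (by positivity)
  have hsum : tailQuotient (r + 1) n z = ∑ i ∈ Finset.range (n - (r + 1) + 1),
      (((n.choose (r + 1 + i) / n.choose (r + 1) : ℝ) * ρ ^ i : ℝ) : ℂ) * (z / (ρ : ℂ)) ^ i := by
    have hρc : (ρ : ℂ) ≠ 0 := by exact_mod_cast hρ0.ne'
    refine Finset.sum_congr rfl fun i _ => ?_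
    push_cast
    rw [div_pow]
    field_simp
  rw [hsum]
  refine le_trans (mul_le_mul_of_nonneg_right ?_
    (sub_nonneg.2 ((Complex.re_le_norm _).trans hw))) hAbel
  have h1 := choose_div_mul_pow_antitone (n := n) (i := 0) hr (by omega)
  simp only [add_zero, zero_add, pow_zero, mul_one, div_self hc.ne', one_mul] at h1 ⊢
  have h2 : (1 / n : ℝ) ≤ 1 - r / (r + 2) := by
    rw [one_sub_div (by linarith), div_le_div_iff₀ (by linarith) (by linarith)]
    linarith
  linarith

theorem norm_tailQuotient_le {r n : ℕ} (hr : 1 ≤ r) (hrn : r + 1 < n) {z : ℂ}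
    (hz : ‖z‖ ≤ (r : ℝ) / (n - r)) : ‖tailQuotient (r + 1) n z‖ ≤ n := by
  have hr' : (1 : ℝ) ≤ r := by exact_mod_cast hr
  have hrn' : (r : ℝ) + 2 ≤ n := by exact_mod_cast hrn
  have hρ0 : 0 < (r : ℝ) / (n - r) := div_pos (by linarith) (by linarith)
  have hfac : (r : ℝ) / (r + 2) ≤ 1 := (div_le_one (by linarith)).2 (by linarith)
  have hc : (0 : ℝ) < n.choose (r + 1) := by exact_mod_cast Nat.choose_pos (by omega)
  have hb : ∀ i, r + 1 + i ≤ n →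
      (n.choose (r + 1 + i) / n.choose (r + 1) : ℝ) * ((r : ℝ) / (n - r)) ^ i ≤ 1 := by
    intro i
    induction i with
    | zero => intro _; simp [div_self hc.ne']
    | succ i ih =>
      intro hi
      refine (choose_div_mul_pow_antitone hr (by omega)).trans ?_
      exact (mul_le_of_le_one_right (by positivity) hfac).trans (ih (by omega))
  refine (norm_sum_le_of_le _ (f := _) (n := fun _ => (1 : ℝ)) fun i hi => ?_).trans ?_
  · have hi' : i < n - (r + 1) + 1 := by simpa using hi
    rw [norm_mul, norm_pow, Complex.norm_real, Real.norm_of_nonneg (by positivity)]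
    refine le_trans ?_ (hb i (by omega))
    gcongr
  · simp only [Finset.sum_const, Finset.card_range, nsmul_eq_mul, mul_one]
    exact_mod_cast (by omega : n - (r + 1) + 1 ≤ n)

/-! ### Exponential growth of binomial coefficients -/

/-- Stirling's formula to the precision needed here: `log n! = n log n - n + o(n)`. -/
theorem tendsto_log_factorial_sub_div :
    Tendsto (fun n : ℕ => (Real.log n.factorial - n * Real.log n + n) / n) atTop (𝓝 0) := by
  have hpi : (√Real.pi) ≠ 0 := (Real.sqrt_pos.2 Real.pi_pos).ne'
  have h1 := (Stirling.tendsto_stirlingSeq_sqrt_pi.log hpi).mul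
    (tendsto_inv_atTop_nhds_zero_nat (𝕜 := ℝ))
  have h2 : Tendsto (fun n : ℕ => (1 / 2 * Real.log 2) * (n : ℝ)⁻¹) atTop (𝓝 0) := by
    simpa using (tendsto_inv_atTop_nhds_zero_nat (𝕜 := ℝ)).const_mul (1 / 2 * Real.log 2)
  have h3 : Tendsto (fun n : ℕ => 1 / 2 * (Real.log n / n)) atTop (𝓝 0) := by
    have := (Real.isLittleO_log_id_atTop.tendsto_div_nhds_zero).comp
      (tendsto_natCast_atTop_atTop (R := ℝ))
    have h := this.const_mul (1 / 2 : ℝ)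
    rw [mul_zero] at h
    exact h
  have h := (h1.add h2).add h3
  simp only [mul_zero, add_zero] at h
  refine h.congr' ?_
  filter_upwards [eventually_ge_atTop 1] with n hn
  have hn0 : (n : ℝ) ≠ 0 := by positivity
  rw [Stirling.log_stirlingSeq_formula, Real.log_mul two_ne_zero hn0,
    Real.log_div hn0 (Real.exp_ne_zero 1), Real.log_exp]
  field_simp
  ring

/-- If `k / n → β` then `C(n, k) ^ (1 / n)` tends to the exponential of the binary entropy of `β`. -/
theorem tendsto_log_choose_div {k n : ℕ → ℕ} {β : ℝ} (hβ0 : 0 < β) (hβ1 : β < 1)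
    (hkn : ∀ j, k j ≤ n j) (hn : Tendsto n atTop atTop)
    (hlim : Tendsto (fun j => (k j : ℝ) / n j) atTop (𝓝 β)) :
    Tendsto (fun j => Real.log ((n j).choose (k j)) / n j) atTop (𝓝 (Real.binEntropy β)) := by
  have hn' : Tendsto (fun j => (n j : ℝ)) atTop atTop := tendsto_natCast_atTop_atTop.comp hn
  have hlim' : Tendsto (fun j => ((n j - k j : ℕ) : ℝ) / n j) atTop (𝓝 (1 - β)) := by
    refine (tendsto_const_nhds.sub hlim).congr' ?_
    filter_upwards [hn.eventually_ge_atTop 1] with j hj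
    have : (n j : ℝ) ≠ 0 := by positivity
    rw [Nat.cast_sub (hkn j)]
    field_simp
  have hunb : ∀ {l : ℕ → ℕ} {γ : ℝ}, 0 < γ →
      Tendsto (fun j => (l j : ℝ) / n j) atTop (𝓝 γ) → Tendsto l atTop atTop := by
    intro l γ hγ hl
    refine tendsto_natCast_atTop_iff.1 ((hl.pos_mul_atTop hγ hn').congr' ?_)
    filter_upwards [hn.eventually_ge_atTop 1] with j hj
    have : (n j : ℝ) ≠ 0 := by positivity
    field_simp
  have hk := hunb hβ0 hlim
  have hk' := hunb (sub_pos.2 hβ1) hlim'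
  have hE := tendsto_log_factorial_sub_div
  have h := ((hE.comp hn).sub ((hE.comp hk).mul hlim)).sub ((hE.comp hk').mul hlim')
  have h' := h.add ((Real.binEntropy_continuous.tendsto β).comp hlim)
  simp only [zero_mul, sub_zero, zero_add] at h'
  refine h'.congr' ?_
  filter_upwards [hn.eventually_ge_atTop 1, hk.eventually_ge_atTop 1,
    hk'.eventually_ge_atTop 1] with j h1 h2 h3
  have e1 : (n j : ℝ) ≠ 0 := by positivity
  have e2 : (k j : ℝ) ≠ 0 := by positivity
  have e3 : ((n j - k j : ℕ) : ℝ) ≠ 0 := by positivity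
  have hq : 1 - (k j : ℝ) / n j = ((n j - k j : ℕ) : ℝ) / n j := by
    rw [Nat.cast_sub (hkn j)]
    field_simp
  have hadd : (n j : ℝ) = k j + ((n j - k j : ℕ) : ℝ) := by
    rw [Nat.cast_sub (hkn j)]; ring
  simp only [Function.comp]
  rw [Real.binEntropy, hq, Nat.choose_eq_factorial_div_factorial (hkn j),
    Nat.cast_div (Nat.factorial_mul_factorial_dvd_factorial (hkn j)) (by positivity),
    Real.log_div (by positivity) (by positivity), Nat.cast_mul,
    Real.log_mul (by positivity) (by positivity), Real.log_inv, Real.log_inv,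
    Real.log_div e2 e1, Real.log_div e3 e1]
  field_simp
  generalize ((n j - k j : ℕ) : ℝ) = d at *
  rw [hadd]
  ring_nf

/-! ### The limit curve -/

theorem curveConst_eq_exp {α : ℝ} (hα0 : 0 < α) (hα1 : α < 1) :
    curveConst α = Real.exp (-Real.binEntropy α) := by
  rw [curveConst, Real.rpow_def_of_pos hα0, Real.rpow_def_of_pos (sub_pos.2 hα1), ← Real.exp_add,
    Real.binEntropy, Real.log_inv, Real.log_inv]
  congr 1
  ring

theorem curveConst_pos {α : ℝ} (hα0 : 0 < α) (hα1 : α < 1) : 0 < curveConst α := by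
  rw [curveConst_eq_exp hα0 hα1]
  exact Real.exp_pos _

/-- The equation of the curve without division. At `z = -1` it reads `1 = 0`, so that point is excluded
on both sides. -/
theorem mem_limitCurve_iff {α : ℝ} (hα0 : 0 < α) (hα1 : α < 1) {z : ℂ} :
    z ∈ limitCurve α ↔ ‖z‖ ^ α = curveConst α * ‖1 + z‖ ∧ ‖z‖ ≤ α / (1 - α) := by
  have hK := curveConst_pos hα0 hα1
  rw [limitCurve, Set.mem_ofPred_eq]
  refine and_congr_left fun _ => ?_
  rcases eq_or_ne (1 + z) 0 with h | h
  · have hz : ‖z‖ = 1 := by rw [show z = -1 by linear_combination h]; simp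
    simp [h, hz, hK.ne]
  · rw [div_eq_iff (norm_ne_zero_iff.2 h)]

theorem ne_zero_of_mem_limitCurve {α : ℝ} (hα0 : 0 < α) (hα1 : α < 1) {z : ℂ}
    (hz : z ∈ limitCurve α) : z ≠ 0 := by
  rintro rfl
  have h := ((mem_limitCurve_iff hα0 hα1).1 hz).1
  rw [norm_zero, Real.zero_rpow hα0.ne'] at h
  simp [(curveConst_pos hα0 hα1).ne] at h

theorem one_add_ne_zero_of_mem_limitCurve {α : ℝ} (hα0 : 0 < α) (hα1 : α < 1) {z : ℂ}
    (hz : z ∈ limitCurve α) : 1 + z ≠ 0 := by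
  intro h
  have h' := hz.1
  rw [h] at h'
  simp [(curveConst_pos hα0 hα1).ne] at h'

/-- The positive real point `α / (1 - α)` satisfies the equation of the curve. -/
theorem endpoint_rpow_eq {α : ℝ} (hα0 : 0 < α) (hα1 : α < 1) :
    (α / (1 - α)) ^ α = curveConst α * (1 + α / (1 - α)) := by
  have hα1' : 0 < 1 - α := sub_pos.2 hα1
  rw [curveConst, Real.div_rpow hα0.le hα1'.le,
    show 1 + α / (1 - α) = (1 - α)⁻¹ by field_simp; ring, Real.rpow_sub hα1', Real.rpow_one]
  field_simp

/-! ### Limits of zeros lie on the curve -/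

theorem tendsto_div_nat_sub {α : ℝ} (hα1 : α < 1) {r n : ℕ → ℕ}
    (hn : Tendsto n atTop atTop) (hlim : Tendsto (fun j => (r j : ℝ) / n j) atTop (𝓝 α)) :
    Tendsto (fun j => (r j : ℝ) / (n j - r j)) atTop (𝓝 (α / (1 - α))) := by
  refine (hlim.div (tendsto_const_nhds.sub hlim) (sub_pos.2 hα1).ne').congr' ?_
  filter_upwards [hn.eventually_ge_atTop 1] with j hj
  have : (n j : ℝ) ≠ 0 := by positivity
  simp only [Pi.div_apply]
  rw [one_sub_div this, div_div_div_cancel_right₀ this]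

theorem tendsto_succ_div {α : ℝ} {r n : ℕ → ℕ}
    (hn : Tendsto n atTop atTop) (hlim : Tendsto (fun j => (r j : ℝ) / n j) atTop (𝓝 α)) :
    Tendsto (fun j => ((r j + 1 : ℕ) : ℝ) / n j) atTop (𝓝 α) := by
  have h : Tendsto (fun j => ((n j : ℝ))⁻¹) atTop (𝓝 0) :=
    tendsto_inv_atTop_zero.comp (tendsto_natCast_atTop_atTop.comp hn)
  have := hlim.add h
  rw [add_zero] at this
  refine this.congr fun j => ?_
  push_cast
  ring

theorem tendsto_log_add_const_div {n : ℕ → ℕ} (hn : Tendsto n atTop atTop) (c : ℝ) :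
    Tendsto (fun j => (Real.log (n j) + c) / n j) atTop (𝓝 0) := by
  have hn' : Tendsto (fun j => (n j : ℝ)) atTop atTop := tendsto_natCast_atTop_atTop.comp hn
  have h1 := (Real.isLittleO_log_id_atTop.tendsto_div_nhds_zero).comp hn'
  have h2 := (tendsto_inv_atTop_zero.comp hn').const_mul c
  have := h1.add h2
  simp only [mul_zero, add_zero] at this
  refine this.congr fun j => ?_
  simp only [Function.comp, id]
  ring

/-- Limits of zeros lie on the curve. Except at the point `α / (1 - α)`, which is on the curve anyway, the
tail quotient at the zeros lies between a multiple of `1 / n` and `n`, so taking `n`-th roots of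
absolute values in `(1 + z) ^ n = C(n, r + 1) z ^ (r + 1) T(z)` gives the equation in the limit. -/
theorem mem_limitCurve_of_tendsto_zeros {α : ℝ} (hα0 : 0 < α) (hα1 : α < 1) {r n : ℕ → ℕ}
    (hr : ∀ j, 1 ≤ r j) (hrn : ∀ j, r j + 1 < n j) (hn : Tendsto n atTop atTop)
    (hlim : Tendsto (fun j => (r j : ℝ) / (n j : ℝ)) atTop (𝓝 α)) {z : ℕ → ℂ} {ζ : ℂ}
    (hz : ∀ j, z j ∈ sectionZeros (r j) (n j)) (hζ : Tendsto z atTop (𝓝 ζ)) :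
    ζ ∈ limitCurve α := by
  have hα1' : 0 < 1 - α := sub_pos.2 hα1
  have hρlim := tendsto_div_nat_sub hα1 hn hlim
  set ρ : ℕ → ℝ := fun j => (r j : ℝ) / (n j - r j) with hρ
  have hzρ : ∀ j, ‖z j‖ ≤ ρ j := fun j =>
    norm_le_of_mem_sectionZeros (hr j) (by have := hrn j; omega) (hz j)
  have hle : ‖ζ‖ ≤ α / (1 - α) := le_of_tendsto_of_tendsto' hζ.norm hρlim hzρ
  have hR : 0 < α / (1 - α) := div_pos hα0 hα1'
  rw [mem_limitCurve_iff hα0 hα1]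
  refine ⟨?_, hle⟩
  by_cases hζR : ζ = (α / (1 - α) : ℝ)
  · rw [hζR, ← Complex.ofReal_one, ← Complex.ofReal_add, Complex.norm_real, Complex.norm_real,
      Real.norm_of_nonneg hR.le, Real.norm_of_nonneg (by positivity), endpoint_rpow_eq hα0 hα1]
  -- The limit of `1 - Re (z / ρ)` is positive, since `ζ ≠ α / (1 - α)`.
  have hw : Tendsto (fun j => 1 - (z j / (ρ j : ℂ)).re) atTop
      (𝓝 (1 - (ζ / ((α / (1 - α) : ℝ) : ℂ)).re)) := by
    refine tendsto_const_nhds.sub ((Complex.continuous_re.tendsto _).comp (hζ.div ?_ ?_))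
    · exact (Complex.continuous_ofReal.tendsto _).comp hρlim
    · exact_mod_cast hR.ne'
  have hδ : 0 < 1 - (ζ / ((α / (1 - α) : ℝ) : ℂ)).re := by
    rw [sub_pos, Complex.div_ofReal_re, div_lt_one hR]
    refine lt_of_le_of_ne ((Complex.re_le_norm ζ).trans hle) fun h => hζR ?_
    have h1 : ‖ζ‖ = ζ.re := le_antisymm (h ▸ hle) (Complex.re_le_norm ζ)
    have h2 : ζ.im = 0 := Complex.abs_re_eq_norm.1 (by rw [h1, abs_of_nonneg (h ▸ hR.le)])
    exact Complex.ext (h.trans (Complex.ofReal_re _).symm) (h2.trans (Complex.ofReal_im _).symm)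
  set δ := (1 - (ζ / ((α / (1 - α) : ℝ) : ℂ)).re) / 2 with hδd
  have hδ0 : 0 < δ := by positivity
  have hn1 : ∀ j, (1 : ℝ) ≤ n j := fun j => by
    have := hrn j
    exact_mod_cast (by omega : 1 ≤ n j)
  -- Two-sided bounds on the tail quotient.
  have hlow : ∀ᶠ j in atTop, δ / (2 * n j) ≤ ‖tailQuotient (r j + 1) (n j) (z j)‖ := by
    filter_upwards [hw.eventually_const_lt (by linarith : δ < _)] with j hj
    have h1 := (le_re_one_sub_mul_tailQuotient (hr j) (hrn j) (hzρ j)).trans (Complex.re_le_norm _)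
    have hn0 := hn1 j
    rw [norm_mul] at h1
    have hρj : 0 < ρ j := by
      have h1 : (1 : ℝ) ≤ r j := by exact_mod_cast hr j
      have h2 : (r j : ℝ) + 1 < n j := by exact_mod_cast hrn j
      exact div_pos (by linarith) (by linarith)
    have h2 : ‖1 - z j / (ρ j : ℂ)‖ ≤ 2 := by
      refine (norm_sub_le _ _).trans ?_
      rw [norm_one, norm_div, Complex.norm_real, Real.norm_of_nonneg hρj.le]
      linarith [(div_le_one hρj).2 (hzρ j)]
    have h3 := h1.trans (mul_le_mul_of_nonneg_right h2 (norm_nonneg _))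
    have h4 : (1 / n j : ℝ) * δ ≤ (1 / n j : ℝ) * (1 - (z j / (ρ j : ℂ)).re) := by gcongr
    have h5 := h4.trans h3
    rw [show δ / (2 * n j) = (1 / n j : ℝ) * δ / 2 by field_simp]
    linarith
  have hT : Tendsto (fun j => Real.log ‖tailQuotient (r j + 1) (n j) (z j)‖ / n j) atTop
      (𝓝 0) := by
    have hl := (tendsto_log_add_const_div hn (-Real.log (δ / 2))).neg
    have hu := tendsto_log_add_const_div hn 0
    rw [neg_zero] at hl
    refine tendsto_of_tendsto_of_tendsto_of_le_of_le' hl hu ?_ ?_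
    · filter_upwards [hlow] with j hj
      have hn0 := hn1 j
      rw [← neg_div]
      gcongr
      have : -(Real.log (n j) + -Real.log (δ / 2)) = Real.log (δ / (2 * n j)) := by
        rw [← div_div, Real.log_div (by positivity : δ / 2 ≠ 0) (by positivity : (n j : ℝ) ≠ 0)]
        ring
      rw [this]
      exact Real.log_le_log (by positivity) hj
    · filter_upwards [hlow] with j hj
      have hn0 := hn1 j
      rw [add_zero]
      gcongr
      · exact lt_of_lt_of_le (by positivity) hj
      · exact norm_tailQuotient_le (hr j) (hrn j) (hzρ j)
  -- Take `n`-th roots of absolute values in `(1 + z) ^ n = C(n, r+1) z ^ (r+1) T(z)`.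
  have hroot : ∀ᶠ j in atTop, Real.exp (Real.log ((n j).choose (r j + 1)) / n j) *
      ‖z j‖ ^ (((r j + 1 : ℕ) : ℝ) / n j) *
      Real.exp (Real.log ‖tailQuotient (r j + 1) (n j) (z j)‖ / n j) = ‖1 + z j‖ := by
    filter_upwards [hlow] with j hj
    have hn0 := hn1 j
    have hnn : n j ≠ 0 := by have := hrn j; omega
    have hTpos : 0 < ‖tailQuotient (r j + 1) (n j) (z j)‖ := lt_of_lt_of_le (by positivity) hj
    have hCpos : (0 : ℝ) < (n j).choose (r j + 1) := by
      exact_mod_cast Nat.choose_pos (hrn j).le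
    have h := one_add_pow_eq_binomialSection_add (r := r j) (n := n j)
      (by have := hrn j; omega) (z j)
    have h0 : binomialSection (r j) (n j) (z j) = 0 := hz j
    rw [h0, zero_add] at h
    have hne : (n j : ℝ) ≠ 0 := by positivity
    rw [← pow_left_inj₀ (by positivity) (by positivity) hnn, ← norm_pow, h, norm_mul, norm_mul,
      norm_pow, mul_pow, mul_pow, ← Real.exp_nat_mul, ← Real.exp_nat_mul, mul_div_cancel₀ _ hne,
      mul_div_cancel₀ _ hne, Real.exp_log hCpos, Real.exp_log hTpos,
      ← Real.rpow_mul_natCast (norm_nonneg _), div_mul_cancel₀ _ hne, Real.rpow_natCast,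
      Complex.norm_natCast]
  have hpow : Tendsto (fun j => ‖z j‖ ^ (((r j + 1 : ℕ) : ℝ) / n j)) atTop (𝓝 (‖ζ‖ ^ α)) :=
    hζ.norm.rpow (tendsto_succ_div hn hlim) (Or.inr hα0)
  have hC := (tendsto_log_choose_div hα0 hα1 (fun j => (hrn j).le) hn
    (tendsto_succ_div hn hlim)).rexp
  have hL := ((hC.mul hpow).mul hT.rexp).congr' hroot
  have := tendsto_nhds_unique hL (tendsto_const_nhds.add hζ).norm
  rw [Real.exp_zero, mul_one] at this
  rw [curveConst_eq_exp hα0 hα1, ← this, ← mul_assoc, ← Real.exp_add, neg_add_cancel,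
    Real.exp_zero, one_mul]

/-! ### Solutions of `exp (n ψ) = 1` -/

/-- If holomorphic `ψ j` converge uniformly near `ζ` to a function with nonzero derivative and purely
imaginary value at `ζ`, then `exp (n j * ψ j z) = 1` has solutions arbitrarily near `ζ`: by a
quantitative open mapping theorem the image of `ψ j` contains a disc about `ψ j ζ` of radius independent
of `j`, and this disc eventually meets the lattice `(2πi / n j) ℤ`. -/
theorem eventually_exists_exp_nat_mul_eq_one {ψ : ℕ → ℂ → ℂ} {φ : ℂ → ℂ} {ζ d : ℂ} {s : ℝ}
    {n : ℕ → ℕ} (hs : 0 < s) (hd : ∀ᶠ j in atTop, DifferentiableOn ℂ (ψ j) (Metric.ball ζ s))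
    (hu : TendstoUniformlyOn ψ φ atTop (Metric.ball ζ s)) (hφ : HasDerivAt φ d ζ) (hd0 : d ≠ 0)
    (hre : (φ ζ).re = 0) (hn : Tendsto n atTop atTop) {ε : ℝ} (hε : 0 < ε) :
    ∀ᶠ j in atTop, ∃ z ∈ Metric.ball ζ s, dist z ζ < ε ∧ Complex.exp (n j * ψ j z) = 1 := by
  obtain ⟨t₀, ht₀, hne⟩ : ∃ t > 0, ∀ z ∈ Metric.ball ζ t, z ≠ ζ → φ z ≠ φ ζ := by
    have h := hφ.eventually_ne (c := φ ζ) hd0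
    rw [eventually_nhdsWithin_iff] at h
    obtain ⟨t, ht, h⟩ := Metric.eventually_nhds_iff_ball.1 h
    exact ⟨t, ht, fun z hz hzζ => h z hz hzζ⟩
  obtain ⟨t, ht, htlt⟩ : ∃ t > 0, t < min t₀ (min s ε) :=
    exists_between (lt_min ht₀ (lt_min hs hε))
  obtain ⟨htt₀, hts, htε⟩ : t < t₀ ∧ t < s ∧ t < ε := by simpa [lt_min_iff] using htlt
  have hcb : Metric.closedBall ζ t ⊆ Metric.ball ζ s := Metric.closedBall_subset_ball hts
  have hsb : Metric.sphere ζ t ⊆ Metric.ball ζ s := Metric.sphere_subset_closedBall.trans hcb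
  have hφc : ContinuousOn φ (Metric.ball ζ s) :=
    hu.continuousOn (hd.mono fun j h => h.continuousOn).frequently
  obtain ⟨z₁, hz₁, hmin⟩ := (isCompact_sphere ζ t).exists_isMinOn
    (NormedSpace.sphere_nonempty.2 ht.le) ((hφc.mono hsb).sub continuousOn_const (g := fun _ => φ ζ)).norm
  set η := ‖φ z₁ - φ ζ‖ with hη
  have hη0 : 0 < η := by
    refine norm_pos_iff.2 (sub_ne_zero.2 (hne z₁ ?_ (Metric.ne_of_mem_sphere hz₁ ht.ne')))
    exact Metric.closedBall_subset_ball htt₀ (Metric.sphere_subset_closedBall hz₁)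
  have hn' : Tendsto (fun j => (n j : ℝ)) atTop atTop := tendsto_natCast_atTop_atTop.comp hn
  have hζs : ζ ∈ Metric.ball ζ s := Metric.mem_ball_self hs
  filter_upwards [hd, Metric.tendstoUniformlyOn_iff.1 hu (η / 8) (by positivity),
    hn'.eventually_gt_atTop (8 * Real.pi / η), hn.eventually_ge_atTop 1] with j hdj huj hnj hn1
  have hnpos : (0 : ℝ) < n j := by positivity
  have hsep : ∀ z ∈ Metric.sphere ζ t, η / 2 ≤ ‖ψ j z - ψ j ζ‖ := by
    intro z hz
    have h1 : η ≤ ‖φ z - φ ζ‖ := hmin hz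
    have h2 := huj z (hsb hz)
    have h3 := huj ζ hζs
    rw [← dist_eq_norm] at h1 ⊢
    have h4 := dist_triangle4 (φ z) (ψ j z) (ψ j ζ) (φ ζ)
    rw [dist_comm (ψ j ζ) (φ ζ)] at h4
    linarith
  have hfreq : ∃ᶠ z in 𝓝 ζ, ψ j z ≠ ψ j ζ := by
    intro hev
    have hev' : ψ j =ᶠ[𝓝 ζ] fun _ => ψ j ζ := hev.mono fun z hz => not_not.1 hz
    have heq := (hdj.analyticOnNhd Metric.isOpen_ball).eqOn_of_preconnected_of_eventuallyEq
      analyticOnNhd_const (convex_ball ζ s).isPreconnected hζs hev'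
    have h1 := hsep z₁ hz₁
    rw [heq (hsb hz₁), sub_self, norm_zero] at h1
    linarith
  have hcl : DiffContOnCl ℂ (ψ j) (Metric.ball ζ t) :=
    (hdj.mono ((Metric.closure_ball_subset_closedBall).trans hcb)).diffContOnCl
  have himage := hcl.ball_subset_image_closedBall ht hsep hfreq
  -- The lattice `(2πi / n) ℤ` comes within `π / n` of the imaginary part of `ψ ζ`.
  set m : ℤ := round ((n j : ℝ) * (ψ j ζ).im / (2 * Real.pi)) with hm
  have hround : |(2 * Real.pi * m / n j) - (ψ j ζ).im| ≤ Real.pi / n j := by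
    have h := abs_sub_round ((n j : ℝ) * (ψ j ζ).im / (2 * Real.pi))
    rw [← hm] at h
    have hpi := Real.pi_pos
    have e : (2 * Real.pi * m / n j) - (ψ j ζ).im =
        -(2 * Real.pi / n j) * ((n j : ℝ) * (ψ j ζ).im / (2 * Real.pi) - m) := by
      field_simp
      ring
    rw [e, abs_mul, abs_neg, abs_of_pos (by positivity : 0 < 2 * Real.pi / n j)]
    calc _ ≤ 2 * Real.pi / n j * (1 / 2) := by gcongr
      _ = _ := by ring
  have hmem : (((2 * Real.pi * m / n j : ℝ) : ℂ) * Complex.I) ∈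
      Metric.ball (ψ j ζ) (η / 2 / 2) := by
    rw [Metric.mem_ball, dist_eq_norm]
    refine (Complex.norm_le_abs_re_add_abs_im _).trans_lt ?_
    have hre' : |(ψ j ζ).re| < η / 8 := by
      have h := (Complex.abs_re_le_norm (φ ζ - ψ j ζ)).trans_lt
        (by rw [← dist_eq_norm]; exact huj ζ hζs)
      rwa [Complex.sub_re, hre, zero_sub, abs_neg] at h
    have hpi : Real.pi / n j < η / 8 := by
      rw [div_lt_iff₀ hη0] at hnj
      rw [div_lt_iff₀ hnpos]
      linarith
    simp only [Complex.sub_re, Complex.sub_im, Complex.re_ofReal_mul, Complex.im_ofReal_mul,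
      Complex.I_re, Complex.I_im, mul_zero, mul_one, zero_sub, abs_neg]
    linarith
  obtain ⟨z, hz, hzv⟩ := himage hmem
  refine ⟨z, hcb hz, (Metric.mem_closedBall.1 hz).trans_lt htε, ?_⟩
  rw [hzv, ← Complex.exp_int_mul_two_pi_mul_I m]
  congr 1
  have : (n j : ℂ) ≠ 0 := by exact_mod_cast hnpos.ne'
  push_cast
  field_simp

/-! ### Bounds and branches of the logarithm -/

theorem norm_clog_le {x : ℂ} {a b : ℝ} (ha : 0 < a) (hax : a ≤ ‖x‖) (hxb : ‖x‖ ≤ b) :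
    ‖Complex.log x‖ ≤ |Real.log a| + |Real.log b| + Real.pi := by
  refine (Complex.norm_le_abs_re_add_abs_im _).trans ?_
  rw [Complex.log_re, Complex.log_im]
  refine add_le_add ?_ (Complex.abs_arg_le_pi x)
  have h1 := Real.log_le_log ha hax
  have h2 := Real.log_le_log (ha.trans_le hax) hxb
  rw [abs_le]
  constructor
  · linarith [neg_abs_le (Real.log a), abs_nonneg (Real.log b)]
  · linarith [le_abs_self (Real.log b), abs_nonneg (Real.log a)]

theorem mem_slitPlane_of_re_pos {x : ℂ} (hx : 0 < x.re) : x ∈ Complex.slitPlane :=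
  Complex.mem_slitPlane_iff.2 (Or.inl hx)

/-- `a ↦ log (a / c) + log c`: a branch of the logarithm that is holomorphic on the disc with centre `c`
and radius `‖c‖`, also when that disc meets the cut of the principal branch. -/
noncomputable def localLog (c a : ℂ) : ℂ := Complex.log (a / c) + Complex.log c

theorem exp_localLog {c a : ℂ} (hc : c ≠ 0) (ha : a ≠ 0) : Complex.exp (localLog c a) = a := by
  rw [localLog, Complex.exp_add, Complex.exp_log (div_ne_zero ha hc), Complex.exp_log hc,
    div_mul_cancel₀ _ hc]

theorem div_re_pos_of_norm_sub_lt {c a : ℂ} (h : ‖a - c‖ < ‖c‖) : 0 < (a / c).re := by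
  have hc : c ≠ 0 := norm_pos_iff.1 ((norm_nonneg _).trans_lt h)
  have h1 : ‖a / c - 1‖ < 1 := by
    rw [div_sub_one hc, norm_div, div_lt_one (norm_pos_iff.2 hc)]
    exact h
  have h2 := (abs_le.1 (Complex.abs_re_le_norm (a / c - 1))).1
  rw [Complex.sub_re, Complex.one_re] at h2
  linarith

theorem hasDerivAt_localLog {c a : ℂ} (h : ‖a - c‖ < ‖c‖) :
    HasDerivAt (localLog c) (1 / a) a := by
  have hc : c ≠ 0 := norm_pos_iff.1 ((norm_nonneg _).trans_lt h)
  have hp := div_re_pos_of_norm_sub_lt h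
  have ha : a ≠ 0 := by rintro rfl; simp at hp
  have h1 := ((hasDerivAt_id a).div_const c).clog (mem_slitPlane_of_re_pos hp)
  refine (h1.add_const (Complex.log c)).congr_deriv ?_
  simp only [id]
  field_simp

theorem localLog_self {c : ℂ} (hc : c ≠ 0) : localLog c c = Complex.log c := by
  rw [localLog, div_self hc, Complex.log_one, zero_add]

theorem norm_localLog_le {c a : ℂ} (hc : c ≠ 0) (h : ‖a - c‖ ≤ ‖c‖ / 2) :
    ‖localLog c a‖ ≤ |Real.log (1 / 2)| + |Real.log 2| + Real.pi + ‖Complex.log c‖ := by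
  have hc' := norm_pos_iff.2 hc
  refine (norm_add_le _ _).trans (add_le_add (norm_clog_le (by norm_num) ?_ ?_) le_rfl)
  · rw [norm_div, le_div_iff₀ hc']
    have := norm_sub_norm_le c a
    rw [norm_sub_rev] at this
    linarith
  · rw [norm_div, div_le_iff₀ hc']
    have := norm_sub_norm_le a c
    linarith

/-! ### Zeros near points of the curve inside the disc -/

/-- Points of the curve inside the open disc `‖z‖ < α / (1 - α)` are limits of zeros. The zeros near such
a point are the solutions of `exp (n * ψ z) = 1`, where `ψ` is `1 / n` times a logarithm of
`C(n, r + 1) z ^ (r + 1) T(z) / (1 + z) ^ n`, and `ψ` tends to `α log z + H(α) - log (1 + z)` with `H` the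
binary entropy. The derivative of this limit vanishes only at `z = α / (1 - α)`. -/
theorem eventually_exists_zero_near_interior {α : ℝ} (hα0 : 0 < α) (hα1 : α < 1) {r n : ℕ → ℕ}
    (hr : ∀ j, 1 ≤ r j) (hrn : ∀ j, r j + 1 < n j) (hn : Tendsto n atTop atTop)
    (hlim : Tendsto (fun j => (r j : ℝ) / (n j : ℝ)) atTop (𝓝 α)) {ζ : ℂ}
    (hζ : ζ ∈ limitCurve α) (hζR : ‖ζ‖ < α / (1 - α)) {ε : ℝ} (hε : 0 < ε) :
    ∀ᶠ j in atTop, ∃ z ∈ sectionZeros (r j) (n j), dist z ζ < ε := by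
  have hα1' : 0 < 1 - α := sub_pos.2 hα1
  have hζ0 := ne_zero_of_mem_limitCurve hα0 hα1 hζ
  have hζ1 := one_add_ne_zero_of_mem_limitCurve hα0 hα1 hζ
  have hζ0' := norm_pos_iff.2 hζ0
  have hζ1' := norm_pos_iff.2 hζ1
  obtain ⟨s, hs, hslt⟩ : ∃ s > 0, s < min (‖ζ‖ / 2) (min ‖1 + ζ‖ ((α / (1 - α) - ‖ζ‖) / 2)) :=
    exists_between (lt_min (by positivity) (lt_min hζ1' (by linarith)))
  obtain ⟨hs1, hs2, hs3⟩ : s < ‖ζ‖ / 2 ∧ s < ‖1 + ζ‖ ∧ s < (α / (1 - α) - ‖ζ‖) / 2 := by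
    simpa only [lt_min_iff] using hslt
  set R := ‖ζ‖ + s with hR
  set R' := R + s with hR'
  have hR'lt : R' < α / (1 - α) := by rw [hR', hR]; linarith
  have hR'0 : 0 < R' := by positivity
  set δ := 1 - R / R' with hδ
  have hδ0 : 0 < δ := by rw [hδ, sub_pos, div_lt_one hR'0]; linarith
  have hball : ∀ z ∈ Metric.ball ζ s, ‖z - ζ‖ < s := fun z hz => by
    rwa [← dist_eq_norm]
  have hballR : ∀ z ∈ Metric.ball ζ s, ‖z‖ ≤ R := fun z hz => by
    have := norm_sub_norm_le z ζ
    linarith [hball z hz]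
  have hb0 : ∀ z ∈ Metric.ball ζ s, ‖z - ζ‖ < ‖ζ‖ := fun z hz => by linarith [hball z hz]
  have hb1 : ∀ z ∈ Metric.ball ζ s, ‖(1 + z) - (1 + ζ)‖ < ‖1 + ζ‖ := fun z hz => by
    rw [add_sub_add_left_eq_sub]; linarith [hball z hz]
  set ρ : ℕ → ℝ := fun j => (r j : ℝ) / (n j - r j) with hρ
  have hρR' : ∀ᶠ j in atTop, R' < ρ j :=
    (tendsto_div_nat_sub hα1 hn hlim).eventually_const_lt hR'lt
  set G : ℕ → ℂ → ℂ := fun j z => (1 - z / (ρ j : ℂ)) * tailQuotient (r j + 1) (n j) z with hG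
  have hn1 : ∀ j, (1 : ℝ) ≤ n j := fun j => by
    have := hrn j
    exact_mod_cast (by omega : 1 ≤ n j)
  have hest : ∀ j, R' < ρ j → ∀ z ∈ Metric.ball ζ s,
      δ ≤ (1 - z / (ρ j : ℂ)).re ∧ ‖1 - z / (ρ j : ℂ)‖ ≤ 2 ∧ δ / n j ≤ (G j z).re ∧
        ‖G j z‖ ≤ 2 * n j := by
    intro j hj z hz
    have hρ0 : 0 < ρ j := hR'0.trans hj
    have hzR := hballR z hz
    have hzρ : ‖z‖ ≤ ρ j := by linarith
    have hw : ‖z / (ρ j : ℂ)‖ ≤ R / R' := by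
      rw [norm_div, Complex.norm_real, Real.norm_of_nonneg hρ0.le]
      gcongr
    have hδre : δ ≤ (1 - z / (ρ j : ℂ)).re := by
      rw [Complex.sub_re, Complex.one_re]
      linarith [Complex.re_le_norm (z / (ρ j : ℂ))]
    have h2 : ‖1 - z / (ρ j : ℂ)‖ ≤ 2 := by
      refine (norm_sub_le _ _).trans ?_
      rw [norm_one]
      linarith
    refine ⟨hδre, h2, ?_, ?_⟩
    · refine le_trans ?_ (le_re_one_sub_mul_tailQuotient (hr j) (hrn j) hzρ)
      rw [div_eq_mul_one_div, mul_comm]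
      rw [Complex.sub_re, Complex.one_re] at hδre
      gcongr
    · rw [hG]
      simp only
      rw [norm_mul]
      exact mul_le_mul h2 (norm_tailQuotient_le (hr j) (hrn j) hzρ) (norm_nonneg _) zero_le_two
  set ℓ : ℕ → ℂ → ℂ := fun j z => Complex.log (G j z) - Complex.log (1 - z / (ρ j : ℂ)) with hℓ
  set c := |Real.log δ| + |Real.log 2| + Real.pi with hc
  have hℓle : ∀ j, R' < ρ j → ∀ z ∈ Metric.ball ζ s, ‖ℓ j z‖ ≤ 2 * (Real.log (n j) + c) := by
    intro j hj z hz
    obtain ⟨h1, h2, h3, h4⟩ := hest j hj z hz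
    have hnj := hn1 j
    have hlog : 0 ≤ Real.log (n j) := Real.log_nonneg hnj
    have e1 := norm_clog_le (by positivity) (h3.trans (Complex.re_le_norm _)) h4
    have e2 := norm_clog_le hδ0 (h1.trans (Complex.re_le_norm _)) h2
    have e3 : |Real.log (δ / n j)| ≤ |Real.log δ| + Real.log (n j) := by
      rw [Real.log_div hδ0.ne' (by positivity)]
      exact (abs_sub _ _).trans (by rw [abs_of_nonneg hlog])
    have e4 : |Real.log (2 * n j)| ≤ |Real.log 2| + Real.log (n j) := by
      rw [Real.log_mul two_ne_zero (by positivity)]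
      exact (abs_add_le _ _).trans (by rw [abs_of_nonneg hlog])
    refine (norm_sub_le _ _).trans ?_
    rw [hc]
    linarith
  set H := Real.binEntropy α with hH
  set ψ : ℕ → ℂ → ℂ := fun j z =>
    (((r j + 1 : ℕ) : ℂ) * localLog ζ z + (Real.log ((n j).choose (r j + 1)) : ℂ) + ℓ j z) / n j -
      localLog (1 + ζ) (1 + z) with hψ
  set φ : ℂ → ℂ := fun z => α * localLog ζ z + H - localLog (1 + ζ) (1 + z) with hφ
  have hderiv0 : ∀ z ∈ Metric.ball ζ s, HasDerivAt (localLog ζ) (1 / z) z := fun z hz =>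
    hasDerivAt_localLog (hb0 z hz)
  have hderiv1 : ∀ z ∈ Metric.ball ζ s,
      HasDerivAt (fun z => localLog (1 + ζ) (1 + z)) (1 / (1 + z)) z := fun z hz =>
    (hasDerivAt_localLog (hb1 z hz)).comp_const_add 1 z
  have hdiff : ∀ᶠ j in atTop, DifferentiableOn ℂ (ψ j) (Metric.ball ζ s) := by
    filter_upwards [hρR'] with j hj z hz
    obtain ⟨h1, -, h3, -⟩ := hest j hj z hz
    have hnj := hn1 j
    have hd1 : DifferentiableAt ℂ (fun z : ℂ => 1 - z / (ρ j : ℂ)) z := by fun_prop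
    have hd2 : DifferentiableAt ℂ (G j) z :=
      hd1.mul (differentiable_tailQuotient (r j + 1) (n j) z)
    have hd3 : DifferentiableAt ℂ (ℓ j) z :=
      (hd2.clog (mem_slitPlane_of_re_pos (lt_of_lt_of_le (by positivity) h3))).sub
        (hd1.clog (mem_slitPlane_of_re_pos (hδ0.trans_le h1)))
    exact ((((hderiv0 z hz).differentiableAt.const_mul _).add_const _).add hd3).div_const _ |>.sub
      (hderiv1 z hz).differentiableAt |>.differentiableWithinAt
  have hζs : ζ ∈ Metric.ball ζ s := Metric.mem_ball_self hs
  have hunif : TendstoUniformlyOn ψ φ atTop (Metric.ball ζ s) := by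
    set L := |Real.log (1 / 2)| + |Real.log 2| + Real.pi + ‖Complex.log ζ‖ with hL
    have t1 := ((tendsto_succ_div hn hlim).sub_const α).abs.mul_const L
    have t2 := ((tendsto_log_choose_div hα0 hα1 (fun j => (hrn j).le) hn
      (tendsto_succ_div hn hlim)).sub_const H).abs
    have t3 := (tendsto_log_add_const_div hn c).const_mul 2
    have t := (t1.add t2).add t3
    simp only [sub_self, abs_zero, zero_mul, mul_zero, add_zero, hH] at t
    rw [Metric.tendstoUniformlyOn_iff]
    intro ε' hε'
    filter_upwards [t.eventually_lt_const hε', hρR'] with j hj hρj z hz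
    refine lt_of_le_of_lt ?_ hj
    have hnj := hn1 j
    have hne : (n j : ℂ) ≠ 0 := by
      have := hrn j
      exact_mod_cast (by omega : n j ≠ 0)
    have e : ψ j z - φ z = ((((r j + 1 : ℕ) : ℝ) / n j - α : ℝ) : ℂ) * localLog ζ z +
        ((Real.log ((n j).choose (r j + 1)) / n j - H : ℝ) : ℂ) + ℓ j z / n j := by
      simp only [hψ, hφ]
      push_cast
      field_simp
      ring
    rw [dist_comm, dist_eq_norm, e]
    refine (norm_add₃_le).trans ?_
    rw [norm_mul, Complex.norm_real, Complex.norm_real, Real.norm_eq_abs, Real.norm_eq_abs,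
      norm_div, Complex.norm_natCast]
    gcongr
    · exact norm_localLog_le hζ0 (by linarith [hball z hz])
    · rw [← mul_div_assoc]
      gcongr
      exact hℓle j hρj z hz
  have hder : HasDerivAt φ (α * (1 / ζ) - 1 / (1 + ζ)) ζ :=
    (((hderiv0 ζ hζs).const_mul (α : ℂ)).add_const (H : ℂ)).sub (hderiv1 ζ hζs)
  have hder0 : (α * (1 / ζ) - 1 / (1 + ζ) : ℂ) ≠ 0 := by
    intro h
    field_simp at h
    have h1 : ζ * ((1 - α : ℝ) : ℂ) = (α : ℝ) := by
      push_cast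
      linear_combination -h
    have h2 := congrArg norm h1
    rw [norm_mul, Complex.norm_real, Complex.norm_real, Real.norm_of_nonneg hα1'.le,
      Real.norm_of_nonneg hα0.le] at h2
    rw [lt_div_iff₀ hα1'] at hζR
    linarith
  have hφre : (φ ζ).re = 0 := by
    have hcurve := ((mem_limitCurve_iff hα0 hα1).1 hζ).1
    have h := congrArg Real.log hcurve
    rw [Real.log_rpow hζ0', curveConst_eq_exp hα0 hα1,
      Real.log_mul (Real.exp_ne_zero _) hζ1'.ne', Real.log_exp] at h
    simp only [hφ]
    rw [localLog_self hζ0, localLog_self hζ1, Complex.sub_re, Complex.add_re,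
      Complex.re_ofReal_mul, Complex.log_re, Complex.log_re, Complex.ofReal_re]
    linarith
  filter_upwards [eventually_exists_exp_nat_mul_eq_one hs hdiff hunif hder hder0 hφre hn hε,
    hρR'] with j hj hρj
  obtain ⟨z, hz, hzε, hexp⟩ := hj
  refine ⟨z, ?_, hzε⟩
  obtain ⟨h1, -, h3, -⟩ := hest j hρj z hz
  have hnj := hn1 j
  have hne : (n j : ℂ) ≠ 0 := by
    have := hrn j
    exact_mod_cast (by omega : n j ≠ 0)
  have hz0 : z ≠ 0 := by
    rintro rfl
    have := hb0 0 hz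
    simp at this
  have hz1 : 1 + z ≠ 0 := by
    intro h
    have := hb1 z hz
    rw [h, zero_sub, norm_neg] at this
    exact this.false
  have hw0 : 1 - z / (ρ j : ℂ) ≠ 0 := by
    intro h
    rw [h, Complex.zero_re] at h1
    linarith
  have hG0 : G j z ≠ 0 := by
    intro h
    rw [h, Complex.zero_re] at h3
    have : 0 < δ / n j := by positivity
    linarith
  have hCpos : (0 : ℝ) < (n j).choose (r j + 1) := by
    exact_mod_cast Nat.choose_pos (hrn j).le
  have hexpl : Complex.exp (ℓ j z) = tailQuotient (r j + 1) (n j) z := by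
    simp only [hℓ]
    rw [Complex.exp_sub, Complex.exp_log hG0, Complex.exp_log hw0]
    simp only [hG]
    rw [mul_div_cancel_left₀ _ hw0]
  have harg : (n j : ℂ) * ψ j z = ((r j + 1 : ℕ) : ℂ) * localLog ζ z +
      (Real.log ((n j).choose (r j + 1)) : ℂ) + ℓ j z -
        (n j : ℂ) * localLog (1 + ζ) (1 + z) := by
    simp only [hψ]
    field_simp
  rw [harg, Complex.exp_sub, Complex.exp_add, Complex.exp_add, Complex.exp_nat_mul,
    Complex.exp_nat_mul, exp_localLog hζ0 hz0, exp_localLog hζ1 hz1, hexpl, ← Complex.ofReal_exp,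
    Real.exp_log hCpos, div_eq_one_iff_eq (pow_ne_zero _ hz1), Complex.ofReal_natCast] at hexp
  have h := one_add_pow_eq_binomialSection_add (r := r j) (n := n j)
    (by have := hrn j; omega) z
  change binomialSection (r j) (n j) z = 0
  linear_combination -h - hexp

/-! ### The point `α / (1 - α)` of the curve -/

/-- Weighted AM-GM for `s / α` and `1 / (1 - α)` with weights `α` and `1 - α`. -/
theorem rpow_le_curveConst_mul_one_add {α : ℝ} (hα0 : 0 < α) (hα1 : α < 1) {s : ℝ} (hs : 0 ≤ s) :
    s ^ α ≤ curveConst α * (1 + s) := by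
  have hα1' : 0 < 1 - α := sub_pos.2 hα1
  have h := Real.geom_mean_le_arith_mean2_weighted hα0.le hα1'.le (div_nonneg hs hα0.le)
    (inv_nonneg.2 hα1'.le) (by ring)
  rw [mul_div_cancel₀ _ hα0.ne', mul_inv_cancel₀ hα1'.ne', Real.div_rpow hs hα0.le,
    Real.inv_rpow hα1'.le, div_mul_eq_mul_div, div_le_iff₀ (by positivity),
    mul_inv_le_iff₀ (by positivity)] at h
  rw [curveConst]
  linarith

theorem sq_norm_one_add (z : ℂ) : ‖1 + z‖ ^ 2 = 1 + 2 * z.re + ‖z‖ ^ 2 := by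
  simp only [Complex.sq_norm, Complex.normSq_apply, Complex.add_re, Complex.add_im, Complex.one_re,
    Complex.one_im]
  ring

/-- The point `α / (1 - α)` is a limit of points of the curve inside the open disc, by the intermediate
value theorem for `‖z‖ ^ α` and `K * ‖1 + z‖` on the intersection of that disc with a small disc about
the point. -/
theorem exists_mem_limitCurve_near_endpoint {α : ℝ} (hα0 : 0 < α) (hα1 : α < 1) {ε : ℝ}
    (hε : 0 < ε) : ∃ ξ ∈ limitCurve α, ‖ξ‖ < α / (1 - α) ∧ dist ξ ((α / (1 - α) : ℝ) : ℂ) < ε := by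
  set R := α / (1 - α) with hRdef
  have hR : 0 < R := div_pos hα0 (sub_pos.2 hα1)
  have hK := curveConst_pos hα0 hα1
  set S := Metric.ball (0 : ℂ) R ∩ Metric.ball (R : ℂ) ε with hS
  have hSc : IsPreconnected S := ((convex_ball _ _).inter (convex_ball _ _)).isPreconnected
  have hf : Continuous fun z : ℂ => ‖z‖ ^ α := continuous_norm.rpow_const fun _ => Or.inr hα0.le
  have hg : Continuous fun z : ℂ => curveConst α * ‖1 + z‖ := by fun_prop
  -- On the positive real axis the inequality is the weighted AM-GM inequality.
  obtain ⟨a, haS, ha⟩ : ∃ a ∈ S, ‖a‖ ^ α ≤ curveConst α * ‖1 + a‖ := by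
    obtain ⟨s, hs1, hs2⟩ : ∃ s, max 0 (R - ε) < s ∧ s < R :=
      exists_between (max_lt hR (by linarith))
    obtain ⟨hs0, hsε⟩ := max_lt_iff.1 hs1
    refine ⟨(s : ℂ), ⟨?_, ?_⟩, ?_⟩
    · rwa [mem_ball_zero_iff, Complex.norm_real, Real.norm_of_nonneg hs0.le]
    · rw [Metric.mem_ball, Complex.dist_eq, ← Complex.ofReal_sub, Complex.norm_real,
        Real.norm_eq_abs, abs_lt]
      constructor <;> linarith
    · rw [← Complex.ofReal_one, ← Complex.ofReal_add, Complex.norm_real, Complex.norm_real,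
        Real.norm_of_nonneg hs0.le, Real.norm_of_nonneg (by positivity)]
      exact rpow_le_curveConst_mul_one_add hα0 hα1 hs0.le
  -- On the circle `‖z‖ = R`, away from the real axis, the inequality is strictly reversed.
  obtain ⟨u, huR, huε, hu⟩ : ∃ u : ℂ, ‖u‖ = R ∧ dist u R < ε ∧
      curveConst α * ‖1 + u‖ < ‖u‖ ^ α := by
    have hc : Continuous fun θ : ℝ => (R : ℂ) * Complex.exp (θ * Complex.I) := by fun_prop
    have hev : ∀ᶠ θ : ℝ in 𝓝[>] 0, dist ((R : ℂ) * Complex.exp (θ * Complex.I)) R < ε := by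
      refine nhdsWithin_le_nhds (((hc.dist continuous_const).tendsto' 0 0 ?_).eventually_lt_const hε)
      simp
    obtain ⟨θ, hθε, hθ0, hθπ⟩ := (hev.and (Ioo_mem_nhdsGT Real.pi_pos)).exists
    have hnorm : ‖(R : ℂ) * Complex.exp (θ * Complex.I)‖ = R := by
      rw [norm_mul, Complex.norm_exp_ofReal_mul_I, mul_one, Complex.norm_real,
        Real.norm_of_nonneg hR.le]
    refine ⟨_, hnorm, hθε, ?_⟩
    rw [hnorm, endpoint_rpow_eq hα0 hα1, ← hRdef]
    refine mul_lt_mul_of_pos_left ?_ hK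
    refine lt_of_pow_lt_pow_left₀ 2 (by positivity) ?_
    rw [sq_norm_one_add, hnorm, Complex.re_ofReal_mul, Complex.exp_ofReal_mul_I_re]
    have hcos : Real.cos θ < 1 := by
      rw [← Real.cos_zero]
      exact Real.cos_lt_cos_of_nonneg_of_le_pi le_rfl hθπ.le hθ0
    nlinarith
  obtain ⟨b, hbS, hb⟩ : ∃ b ∈ S, curveConst α * ‖1 + b‖ ≤ ‖b‖ ^ α := by
    have hucl : u ∈ closure (Metric.ball (0 : ℂ) R) := by
      rw [closure_ball _ hR.ne', mem_closedBall_zero_iff, huR]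
    obtain ⟨b, ⟨hb1, hb2⟩, hb3⟩ := mem_closure_iff.1 hucl
      (Metric.ball (R : ℂ) ε ∩ {z | curveConst α * ‖1 + z‖ < ‖z‖ ^ α})
      (Metric.isOpen_ball.inter (isOpen_lt hg hf)) ⟨huε, hu⟩
    exact ⟨b, ⟨hb3, hb1⟩, le_of_lt hb2⟩
  obtain ⟨ξ, hξS, hξ⟩ := hSc.intermediate_value₂ haS hbS hf.continuousOn hg.continuousOn ha hb
  have hξR : ‖ξ‖ < R := mem_ball_zero_iff.1 hξS.1
  exact ⟨ξ, (mem_limitCurve_iff hα0 hα1).2 ⟨hξ, hξR.le⟩, hξR, hξS.2⟩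

/-- The curve meets the circle `‖z‖ = α / (1 - α)` only at its positive real point. -/
theorem eq_endpoint_of_mem_limitCurve {α : ℝ} (hα0 : 0 < α) (hα1 : α < 1) {ζ : ℂ}
    (hζ : ζ ∈ limitCurve α) (hζR : ‖ζ‖ = α / (1 - α)) : ζ = ((α / (1 - α) : ℝ) : ℂ) := by
  have h := ((mem_limitCurve_iff hα0 hα1).1 hζ).1
  rw [hζR, endpoint_rpow_eq hα0 hα1] at h
  have h1 := mul_left_cancel₀ (curveConst_pos hα0 hα1).ne' h
  have h2 := sq_norm_one_add ζ
  rw [← h1, hζR] at h2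
  have hre : ζ.re = α / (1 - α) := by linarith
  have hR : 0 ≤ α / (1 - α) := hζR ▸ norm_nonneg ζ
  have him : ζ.im = 0 := Complex.abs_re_eq_norm.1 (by rw [hre, hζR, abs_of_nonneg hR])
  exact Complex.ext (hre.trans (Complex.ofReal_re _).symm) (him.trans (Complex.ofReal_im _).symm)

/-! ### Zeros near every point of the curve -/

theorem eventually_exists_zero_near {α : ℝ} (hα0 : 0 < α) (hα1 : α < 1) {r n : ℕ → ℕ}
    (hr : ∀ j, 1 ≤ r j) (hrn : ∀ j, r j + 1 < n j) (hn : Tendsto n atTop atTop)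
    (hlim : Tendsto (fun j => (r j : ℝ) / (n j : ℝ)) atTop (𝓝 α)) {ζ : ℂ}
    (hζ : ζ ∈ limitCurve α) {ε : ℝ} (hε : 0 < ε) :
    ∀ᶠ j in atTop, ∃ z ∈ sectionZeros (r j) (n j), dist z ζ < ε := by
  rcases hζ.2.lt_or_eq with h | h
  · exact eventually_exists_zero_near_interior hα0 hα1 hr hrn hn hlim hζ h hε
  · obtain ⟨ξ, hξ, hξR, hξε⟩ := exists_mem_limitCurve_near_endpoint hα0 hα1 (half_pos hε)
    rw [← eq_endpoint_of_mem_limitCurve hα0 hα1 hζ h] at hξε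
    filter_upwards [eventually_exists_zero_near_interior hα0 hα1 hr hrn hn hlim hξ hξR
      (half_pos hε)] with j hj
    obtain ⟨z, hz, hzξ⟩ := hj
    exact ⟨z, hz, by linarith [dist_triangle z ξ ζ]⟩

theorem continuous_binomialSection (r n : ℕ) : Continuous (binomialSection r n) := by
  unfold binomialSection
  fun_prop

theorem sectionZeros_nonempty {r n : ℕ} (hr : 1 ≤ r) (hrn : r ≤ n) :
    (sectionZeros r n).Nonempty := by
  set p : Polynomial ℂ :=
    ∑ k ∈ Finset.range (r + 1), Polynomial.C (n.choose k : ℂ) * Polynomial.X ^ k with hp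
  have hcoeff : p.coeff r ≠ 0 := by
    rw [hp, Polynomial.finsetSum_coeff]
    simp only [Polynomial.coeff_C_mul, Polynomial.coeff_X_pow, mul_ite, mul_one, mul_zero]
    rw [Finset.sum_ite_eq, if_pos (by simp)]
    exact_mod_cast (Nat.choose_pos hrn).ne'
  have hdeg : 0 < p.degree := Polynomial.natDegree_pos_iff_degree_pos.1
    (lt_of_lt_of_le hr (Polynomial.le_natDegree_of_ne_zero hcoeff))
  obtain ⟨z, hz⟩ := Complex.exists_root hdeg
  refine ⟨z, ?_⟩
  change binomialSection r n z = 0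
  rw [Polynomial.IsRoot.def, hp, Polynomial.eval_finsetSum] at hz
  simpa [binomialSection] using hz

theorem theorem2 (α : ℝ) (hα0 : 0 < α) (hα1 : α < 1) (r n : ℕ → ℕ)
    (hr : ∀ j, 1 ≤ r j) (hrn : ∀ j, r j + 1 < n j)
    (hn : Tendsto n atTop atTop)
    (hlim : Tendsto (fun j => (r j : ℝ) / (n j : ℝ)) atTop (𝓝 α)) :
    Tendsto (fun j => ⨆ z ∈ sectionZeros (r j) (n j), Metric.infEDist z (limitCurve α))
        atTop (𝓝 0) ∧
      ∀ ζ ∈ limitCurve α, ∃ z : ℕ → ℂ,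
        (∀ j, z j ∈ sectionZeros (r j) (n j)) ∧ Tendsto z atTop (𝓝 ζ) := by
  constructor
  · rw [ENNReal.tendsto_nhds_zero]
    intro ε hε
    by_contra hcon
    -- Zeros staying away from the curve along a subsequence would accumulate off the curve.
    have hR : ∀ᶠ j in atTop, (r j : ℝ) / (n j - r j) < α / (1 - α) + 1 :=
      (tendsto_div_nat_sub hα1 hn hlim).eventually_lt_const (lt_add_one _)
    have hfreq : ∃ᶠ j in atTop, ∃ z ∈ sectionZeros (r j) (n j),
        z ∈ Metric.closedBall (0 : ℂ) (α / (1 - α) + 1) ∧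
          ε < Metric.infEDist z (limitCurve α) := by
      refine ((not_eventually.1 hcon).and_eventually hR).mono fun j hj => ?_
      obtain ⟨hj1, hj2⟩ := hj
      simp only [iSup_le_iff, not_forall, not_le] at hj1
      obtain ⟨z, hz, hzε⟩ := hj1
      refine ⟨z, hz, mem_closedBall_zero_iff.2 ?_, hzε⟩
      exact (norm_le_of_mem_sectionZeros (hr j) (by have := hrn j; omega) hz).trans hj2.le
    obtain ⟨σ, hσ, hbad⟩ := extraction_of_frequently_atTop hfreq
    choose z hz hzR hzε using hbad
    obtain ⟨ζ, -, τ, hτ, hζ⟩ := (isCompact_closedBall (0 : ℂ) (α / (1 - α) + 1)).tendsto_subseq hzR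
    have hστ : Tendsto (σ ∘ τ) atTop atTop := (hσ.comp hτ).tendsto_atTop
    have hmem : ζ ∈ limitCurve α :=
      mem_limitCurve_of_tendsto_zeros hα0 hα1 (r := r ∘ σ ∘ τ) (n := n ∘ σ ∘ τ)
        (fun j => hr _) (fun j => hrn _) (hn.comp hστ) (hlim.comp hστ) (fun j => hz (τ j)) hζ
    have hlim0 := (Metric.continuous_infEDist (s := limitCurve α)).tendsto ζ |>.comp hζ
    rw [Metric.infEDist_zero_of_mem hmem] at hlim0
    obtain ⟨j, hj⟩ := (hlim0.eventually_lt_const hε).exists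
    exact lt_asymm hj (hzε (τ j))
  · intro ζ hζ
    have hnearest : ∀ j, ∃ z ∈ sectionZeros (r j) (n j),
        Metric.infDist ζ (sectionZeros (r j) (n j)) = dist ζ z := fun j =>
      (isClosed_eq (continuous_binomialSection (r j) (n j)) continuous_const).exists_infDist_eq_dist
        (sectionZeros_nonempty (hr j) (by have := hrn j; omega)) ζ
    choose z hz hdist using hnearest
    refine ⟨z, hz, Metric.tendsto_nhds.2 fun ε hε => ?_⟩
    filter_upwards [eventually_exists_zero_near hα0 hα1 hr hrn hn hlim hζ hε] with j hj
    obtain ⟨x, hx, hxε⟩ := hj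
    rw [dist_comm, ← hdist j]
    exact (Metric.infDist_le_dist_of_mem hx).trans_lt (by rwa [dist_comm])
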